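/- **Definitions.** A sequence $M=(M_j)_{j\ge 0}$ of real numbers is *strongly regular* if $M_0=1$, $M$ is non-decreasing and logarithmically convex, and there is a constant $A>0$ such that $M_{j+k}\le A^{j+k}M_jM_k$ for all $j,k\in\mathbb N$ and $\sum_{j\ge \ell}\frac{M_j}{(j+1)M_{j+1}}\le A\frac{M_\ell}{M_{\ell+1}}$ for all $\ell\in\mathbb N$. Put $m_j=M_{j+1}/M_j$. For real $\gamma>0$, $M$ satisfies $(\mathsf P_\gamma)$ if there are a real sequence $(m'_j)_{j\ge0}$ and a constant $a\ge 1$ such that $(j+1)^{-\gamma}m'_j$ is non-decreasing in $j$ and $a^{-1}m_j\le m'_j\le a\,m_j$ for all $j$. The *growth index* is $\gamma(M)=\sup\{\gamma>0 : (\mathsf P_\gamma)\text{ holds}\}$. Put $h_M(t)=\inf_{j\ge 0}t^jM_j$ for $t>0$ and $h_M(0)=0$. For $\gamma>0$ let $S_\gamma=\{z\in\Sigma : |\operatorname{Arg} z|<\gamma\pi/2\}$, where $\Sigma$ is the Riemann surface of the logarithm. The class $\mathcal A_M(S_\gamma)$ consists of the holomorphic functions $f$ on $S_\gamma$ for which there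 are constants $C,\sigma>0$ with $|f^{(j)}(z)|\le C\sigma^j j!\,M_j$ for all $j\in\mathbb N$ and $z\in S_\gamma$, derivatives being taken with respect to $z$. Such an $f$ is *flat* at the vertex if $f^{(j)}(z)\to 0$ as $z\to 0$ in $S_\gamma$, for every $j\in\mathbb N$. **Theorem.** Let $M$ be a strongly regular sequence and let $0<\gamma<\gamma(M)$. There exist positive constants $\kappa_1,\kappa_2,\kappa_3,b_1,b_2,c_1,c_2,c_3$, depending only on $M$ and $\gamma$, and a function $G\in\mathcal A_M(S_\gamma)$, flat at the vertex and without zeros in $S_\gamma$, such that for all $z\in S_\gamma$ $$\kappa_1h_M(\kappa_2|z|)\le |G(z)|\le h_M(\kappa_3|z|),$$ and for all $z\in S_\gamma$ and all $j\in\mathbb N$ $$|G^{(j)}(z)|\le b_1^{\,j}\,j!\,M_j\,h_M(b_2|z|),\qquad \Big|\Big(\frac1G\Big)^{(j)}(z)\Big|\le c_1c_2^{\,j}\,j!\,M_j\,\big(h_M(c_3|z|)\big)^{-1}.$$ -/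

import Mathlib

open Filter Topology
open scoped Nat

noncomputable section

/-! ### Strongly regular sequences -/

/-- Strongly regular sequences of real numbers. Conditions `one` and `mono` make all terms at
least `1`, so that `logConvex` is the logarithmic convexity of a positive sequence. -/
structure StronglyRegular (M : ℕ → ℝ) : Prop where
  /-- normalization -/
  one : M 0 = 1
  /-- the sequence is non-decreasing -/
  mono : Monotone M
  /-- logarithmic convexity -/
  logConvex : ∀ j, M (j + 1) ^ 2 ≤ M j * M (j + 2)
  /-- moderate growth and strong non-quasianalyticity; the sum over `j ≥ ℓ` is written as the
  sum over `i ≥ 0` with `j = ℓ + i`, and its convergence is part of the condition -/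
  growth : ∃ A : ℝ, 0 < A ∧
    (∀ j k, M (j + k) ≤ A ^ (j + k) * M j * M k) ∧
    (∀ ℓ, Summable (fun i : ℕ => M (ℓ + i) / (((ℓ + i : ℕ) + 1 : ℝ) * M (ℓ + i + 1))) ∧
      ∑' i : ℕ, M (ℓ + i) / (((ℓ + i : ℕ) + 1 : ℝ) * M (ℓ + i + 1)) ≤ A * (M ℓ / M (ℓ + 1)))

/-- The sequence of quotients `m j = M (j + 1) / M j`. -/
def quotientSeq (M : ℕ → ℝ) (j : ℕ) : ℝ := M (j + 1) / M j

/-- Property `P_γ`: up to bounded factors, the sequence of quotients is a sequence `m'` for which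
`(j + 1) ^ (-γ) * m' j` increases. -/
def PropertyP (M : ℕ → ℝ) (γ : ℝ) : Prop :=
  ∃ (m' : ℕ → ℝ) (a : ℝ), 1 ≤ a ∧
    Monotone (fun j : ℕ => ((j : ℝ) + 1) ^ (-γ) * m' j) ∧
    ∀ j, a⁻¹ * quotientSeq M j ≤ m' j ∧ m' j ≤ a * quotientSeq M j

/-- The growth index of `M`: the supremum, taken in the extended reals, of all positive `γ` such
that `P_γ` holds. -/
def growthIndex (M : ℕ → ℝ) : EReal :=
  sSup {x : EReal | ∃ γ : ℝ, 0 < γ ∧ PropertyP M γ ∧ x = (γ : EReal)}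

/-- The function `h_M` on `[0, ∞)`: `h_M t = inf_j t ^ j * M j` for `t > 0`, and `h_M 0 = 0`. -/
def hFun (M : ℕ → ℝ) (t : ℝ) : ℝ :=
  if 0 < t then ⨅ j : ℕ, t ^ j * M j else 0

/-! ### The Riemann surface of the logarithm -/

/-- The Riemann surface of the logarithm. On it the logarithm is single-valued, and a bijection
onto `ℂ`: a point is given by the value of its logarithm `log |z| + i Arg z`. -/
@[ext]
structure LogSurface where
  /-- the logarithm of the point -/
  logValue : ℂ

namespace LogSurface

/-- The topology for which the logarithm is a homeomorphism onto `ℂ`. -/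
instance : TopologicalSpace LogSurface := TopologicalSpace.induced logValue inferInstance

/-- The covering projection onto `ℂ ∖ {0}`, that is, the local coordinate `z`. -/
def proj (p : LogSurface) : ℂ := Complex.exp p.logValue

/-- The modulus `|z|`. -/
def modulus (p : LogSurface) : ℝ := Real.exp p.logValue.re

/-- The argument, a real number that is not reduced modulo `2π`. -/
def arg (p : LogSurface) : ℝ := p.logValue.im

/-- The sector `S_γ`, of opening `γπ` and bisected by the positive half-line. -/
def sector (γ : ℝ) : Set LogSurface := {p | |p.arg| < γ * (Real.pi / 2)}

/-- The function `f` has complex derivative `f'` at `p` with respect to the coordinate `z`. -/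
def HasDerivAt (f : LogSurface → ℂ) (f' : ℂ) (p : LogSurface) : Prop :=
  Tendsto (fun q => (f q - f p) / (q.proj - p.proj)) (𝓝[≠] p) (𝓝 f')

/-- The derivative `df/dz` (meaningful at the points where `f` has a derivative). -/
def deriv (f : LogSurface → ℂ) (p : LogSurface) : ℂ :=
  limUnder (𝓝[≠] p) (fun q => (f q - f p) / (q.proj - p.proj))

/-- The derivative of order `j` with respect to `z`. -/
def iteratedDeriv (j : ℕ) (f : LogSurface → ℂ) : LogSurface → ℂ := deriv^[j] f

/-- Holomorphy on a set `S`, to be used for open `S`. -/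
def HolomorphicOn (f : LogSurface → ℂ) (S : Set LogSurface) : Prop :=
  ∀ p ∈ S, ∃ f' : ℂ, HasDerivAt f f' p

/-- The ultraholomorphic class `A_M(S)`, for open `S`: the functions holomorphic on `S` whose
derivatives of any order `j` are bounded on `S` by `C * σ ^ j * j! * M j`. -/
def ultraholomorphicClass (M : ℕ → ℝ) (S : Set LogSurface) : Set (LogSurface → ℂ) :=
  {f | HolomorphicOn f S ∧ ∃ C σ : ℝ, 0 < C ∧ 0 < σ ∧
    ∀ j : ℕ, ∀ p ∈ S, ‖iteratedDeriv j f p‖ ≤ C * σ ^ j * (j ! : ℝ) * M j}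

/-- The filter `z → 0` within `S`. -/
def vertexWithin (S : Set LogSurface) : Filter LogSurface := comap modulus (𝓝 0) ⊓ 𝓟 S

/-- The function `f` on `S` is flat at the vertex: all derivatives `f^(j)(0)`, that is, all limits
of the derivatives of `f` at the vertex, are zero. -/
def FlatAtVertex (f : LogSurface → ℂ) (S : Set LogSurface) : Prop :=
  ∀ j : ℕ, Tendsto (iteratedDeriv j f) (vertexWithin S) (𝓝 0)

end LogSurface

end

/-! Pick `γ < θ < δ` with `PropertyP M δ`, let `m'` be the regularized quotients and `n j = m' j ^
(1/θ)`. As `δ/θ > 1`, the series of `1 / n j` converges and the product `P(u) = ∏ (1 + u / n j)` has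
genus zero. The map `u = z ^ (-1/θ)` sends `S_θ` into the right half-plane, and `G = P(u) ^ (-θ)`.
There `|1 + w| ≥ max 1 |w|`, so keeping only the first `J` factors gives `|G| ≤ (a|z|)^J M_J` for
every `J`, that is, the upper bound by `h_M`. Conversely, by `exists_sum_log_one_add_le`, the tail
of `log |P|` is at most a constant times one plus the number of `n j ≤ |u|`, hence is controlled by
the head; this bounds `|G|` below by a power of `h_M`, and moderate growth trades the power for a
dilation (`exists_nonvanishing_hFun_bounds`). Cauchy's estimates on discs of radius `r|z|`, from
`S_θ` to `S_γ`, bound the derivatives of `G` and `1/G`; `hFun_le_mul_pow` absorbs the factor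
`|z|^(-j)`. -/

/-! ### Derivatives and Cauchy estimates on the Riemann surface of the logarithm. -/

namespace LogSurface

/-- A function on the surface, read in the logarithmic coordinate, is differentiated as such. -/
theorem hasDerivAt_of_logCoord {f : LogSurface → ℂ} {d : ℂ} {p : LogSurface}
    (h : _root_.HasDerivAt (fun ζ => f ⟨ζ⟩) d p.logValue) :
    LogSurface.HasDerivAt f (d / p.proj) p := by
  have hcont : Tendsto logValue (𝓝[≠] p) (𝓝[≠] p.logValue) := by
    refine tendsto_nhdsWithin_of_tendsto_nhds_of_eventually_within _
      ((continuous_induced_dom.tendsto p).mono_left nhdsWithin_le_nhds) ?_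
    filter_upwards [self_mem_nhdsWithin] with q hq hq'
    exact hq (LogSurface.ext hq')
  have h1 := (hasDerivAt_iff_tendsto_slope.1 h).comp hcont
  have h2 := (hasDerivAt_iff_tendsto_slope.1 (Complex.hasDerivAt_exp p.logValue)).comp hcont
  refine (h1.div h2 (Complex.exp_ne_zero _)).congr' ?_
  filter_upwards [self_mem_nhdsWithin] with q hq
  have : q.logValue - p.logValue ≠ 0 := fun hq' => hq (LogSurface.ext (sub_eq_zero.1 hq'))
  simp only [Pi.div_apply, Function.comp_apply, slope_def_field, proj]
  rw [div_div_div_cancel_right₀ this]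

/-- Makes the limit defining `deriv` unique. -/
instance neBot_punctured_nhds (p : LogSurface) : (𝓝[≠] p).NeBot := by
  have hcont : Tendsto LogSurface.mk (𝓝[≠] p.logValue) (𝓝[≠] p) := by
    have : Continuous LogSurface.mk := continuous_induced_rng.2 continuous_id
    refine tendsto_nhdsWithin_of_tendsto_nhds_of_eventually_within _
      ((this.tendsto p.logValue).mono_left nhdsWithin_le_nhds) ?_
    filter_upwards [self_mem_nhdsWithin] with q hq hq'
    exact hq (congrArg logValue hq')
  exact hcont.neBot

theorem HasDerivAt.deriv {f : LogSurface → ℂ} {d : ℂ} {p : LogSurface}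
    (h : LogSurface.HasDerivAt f d p) : LogSurface.deriv f p = d :=
  Tendsto.limUnder_eq h

/-- The branch near `p` of the inverse of the covering projection. -/
noncomputable def branch (p : LogSurface) (w : ℂ) : LogSurface :=
  ⟨p.logValue + Complex.log (w / p.proj)⟩

theorem proj_ne_zero (p : LogSurface) : p.proj ≠ 0 := Complex.exp_ne_zero _

theorem norm_proj (p : LogSurface) : ‖p.proj‖ = p.modulus := Complex.norm_exp _

theorem modulus_pos (p : LogSurface) : 0 < p.modulus := Real.exp_pos _

theorem proj_branch (p : LogSurface) {w : ℂ} (hw : w ≠ 0) : (p.branch w).proj = w := by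
  have := p.proj_ne_zero
  rw [branch, proj, Complex.exp_add, Complex.exp_log (div_ne_zero hw this)]
  change p.proj * _ = w
  field_simp

theorem branch_proj (p : LogSurface) : p.branch p.proj = p := by
  ext
  simp [branch, div_self p.proj_ne_zero]

/-- In a simply connected neighbourhood, derivatives on the surface are derivatives in the plane. -/
theorem iteratedDeriv_eq {U : Set ℂ} (hU : IsOpen U) (p : LogSurface) {D : Set ℂ} (hD : IsOpen D)
    (hslit : ∀ w ∈ D, w / p.proj ∈ Complex.slitPlane)
    (hDU : ∀ w ∈ D, (p.branch w).logValue ∈ U) (j : ℕ) :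
    ∀ f : LogSurface → ℂ, DifferentiableOn ℂ (fun ζ => f ⟨ζ⟩) U →
      DifferentiableOn ℂ (fun w => f (p.branch w)) D ∧
      Set.EqOn (_root_.iteratedDeriv j (fun w => f (p.branch w)))
        (fun w => LogSurface.iteratedDeriv j f (p.branch w)) D := by
  induction j with
  | zero =>
    intro f hf
    refine ⟨fun w hw => ?_, fun w _ => by simp [LogSurface.iteratedDeriv]⟩
    have h1 : DifferentiableAt ℂ (fun w => (p.branch w).logValue) w := by
      unfold branch
      exact ((differentiableAt_id.div_const _).clog (hslit w hw)).const_add _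
    have h2 := (hf _ (hDU w hw)).differentiableAt (hU.mem_nhds (hDU w hw))
    exact (DifferentiableAt.comp (f := fun w => (p.branch w).logValue) w h2 h1
      ).differentiableWithinAt
  | succ j ih =>
    intro f hf
    refine ⟨(ih f hf).1, ?_⟩
    have hder : ∀ ζ ∈ U, LogSurface.deriv f ⟨ζ⟩ =
        _root_.deriv (fun ζ => f ⟨ζ⟩) ζ / Complex.exp ζ := fun ζ hζ =>
      (hasDerivAt_of_logCoord (p := ⟨ζ⟩)
        ((hf ζ hζ).differentiableAt (hU.mem_nhds hζ)).hasDerivAt).deriv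
    -- In the logarithmic coordinate `d/dz` is `exp (-ζ) d/dζ`, which preserves holomorphy on `U`;
    -- the induction can restart from `deriv f`.
    have hf' : DifferentiableOn ℂ (fun ζ => LogSurface.deriv f ⟨ζ⟩) U :=
      ((hf.deriv hU).div Complex.differentiable_exp.differentiableOn
        fun ζ _ => Complex.exp_ne_zero ζ).congr hder
    have heq : Set.EqOn (_root_.deriv (fun w => f (p.branch w)))
        (fun w => LogSurface.deriv f (p.branch w)) D := by
      intro w hw
      have hw0 : w ≠ 0 := by
        rintro rfl
        simpa using hslit 0 hw
      have h1 : _root_.HasDerivAt (fun w => (p.branch w).logValue) (1 / p.proj / (w / p.proj)) w :=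
        (((hasDerivAt_id w).div_const _).clog (hslit w hw)).const_add _
      have h2 := ((hf _ (hDU w hw)).differentiableAt (hU.mem_nhds (hDU w hw))).hasDerivAt
      have h3 := HasDerivAt.comp (h := fun w => (p.branch w).logValue) w h2 h1
      have h4 := p.proj_ne_zero
      have h5 : Complex.exp (p.branch w).logValue = w := p.proj_branch hw0
      refine h3.deriv.trans ?_
      change _ = LogSurface.deriv f ⟨(p.branch w).logValue⟩
      rw [hder _ (hDU w hw), h5]
      field_simp
    intro w hw
    rw [iteratedDeriv_succ']
    exact (heq.iteratedDeriv_of_isOpen hD j hw).trans ((ih _ hf').2 hw)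

/-- Cauchy's estimates on the surface. -/
theorem norm_iteratedDeriv_le {f : LogSurface → ℂ} {θ γ : ℝ}
    (hf : DifferentiableOn ℂ (fun ζ => f ⟨ζ⟩) {ζ : ℂ | |ζ.im| < θ * (Real.pi / 2)})
    {r : ℝ} (hr : 0 < r) (hr' : r < 1 / 4) (hrγ : 3 * r ≤ (θ - γ) * (Real.pi / 2))
    {p : LogSurface} (hp : p ∈ sector γ) {B : ℝ}
    (hB : ∀ q ∈ sector θ, (1 - r) * p.modulus ≤ q.modulus → q.modulus ≤ (1 + r) * p.modulus →
      ‖f q‖ ≤ B) (j : ℕ) :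
    ‖LogSurface.iteratedDeriv j f p‖ ≤ (j ! : ℝ) * B / (r * p.modulus) ^ j := by
  have hm := p.modulus_pos
  have h0 := p.proj_ne_zero
  have key : ∀ w ∈ Metric.ball p.proj (2 * r * p.modulus), w ≠ 0 ∧
      w / p.proj ∈ Complex.slitPlane ∧ p.branch w ∈ sector θ := by
    intro w hw
    rw [Metric.mem_ball, dist_eq_norm] at hw
    have hv : ‖w / p.proj - 1‖ < 2 * r := by
      rw [show w / p.proj - 1 = (w - p.proj) / p.proj by field_simp, norm_div, norm_proj,
        div_lt_iff₀ hm]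
      exact hw
    have hs : w / p.proj ∈ Complex.slitPlane := by
      have := Complex.mem_slitPlane_of_norm_lt_one (z := w / p.proj - 1) (by linarith)
      simpa using this
    refine ⟨?_, hs, ?_⟩
    · rintro rfl
      simp at hs
    -- Moving by less than `2r|z|` changes the argument by less than `(3/2) * 2r = 3r`, hence the
    -- hypotheses on `r`.
    · have h1 := Complex.norm_log_one_add_half_le_self (z := w / p.proj - 1) (by linarith)
      rw [add_sub_cancel] at h1
      have h2 := Complex.abs_im_le_norm (Complex.log (w / p.proj))
      have h3 : |p.logValue.im| < γ * (Real.pi / 2) := hp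
      have h4 := abs_add_le p.logValue.im (Complex.log (w / p.proj)).im
      change |(p.logValue + Complex.log (w / p.proj)).im| < _
      rw [Complex.add_im]
      linarith
  have hU : IsOpen {ζ : ℂ | |ζ.im| < θ * (Real.pi / 2)} :=
    isOpen_lt (continuous_abs.comp Complex.continuous_im) continuous_const
  obtain ⟨hd, he⟩ := iteratedDeriv_eq hU p Metric.isOpen_ball (fun w hw => (key w hw).2.1)
    (fun w hw => (key w hw).2.2) j f hf
  have hsub : Metric.closedBall p.proj (r * p.modulus) ⊆
      Metric.ball p.proj (2 * r * p.modulus) :=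
    Metric.closedBall_subset_ball (by nlinarith [mul_pos hr hm])
  have hc := Complex.norm_iteratedDeriv_le_of_forall_mem_sphere_norm_le (C := B) j
    (mul_pos hr hm) ((hd.mono hsub).diffContOnCl_ball subset_rfl) (fun w hw => by
      obtain ⟨hw0, -, hwθ⟩ := key w (hsub (Metric.sphere_subset_closedBall hw))
      have hmw : (p.branch w).modulus = ‖w‖ := by rw [← norm_proj, proj_branch p hw0]
      rw [mem_sphere_iff_norm] at hw
      refine hB _ hwθ ?_ ?_ <;> rw [hmw]
      · have := norm_sub_norm_le p.proj w
        rw [norm_sub_rev, hw, norm_proj] at this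
        linarith
      · have := norm_sub_norm_le w p.proj
        rw [hw, norm_proj] at this
        linarith)
  rw [he (Metric.mem_ball_self (by positivity))] at hc
  simpa only [branch_proj] using hc

end LogSurface

/-! ### Canonical products with negative zeros, on the right half-plane -/

/-- Mean value inequality on the convex half-plane, where the derivative `1 / (1 + x)` has modulus
at most `1`. -/
theorem Complex.norm_log_one_add_le_of_re_nonneg {w : ℂ} (hw : 0 ≤ w.re) :
    ‖Complex.log (1 + w)‖ ≤ ‖w‖ := by
  have hs : ∀ x ∈ {x : ℂ | 0 ≤ x.re}, HasDerivWithinAt (fun x => Complex.log (1 + x))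
      (1 / (1 + x)) {x : ℂ | 0 ≤ x.re} x := fun x hx =>
    (((hasDerivAt_id x).const_add 1).clog (Or.inl (by
      have : 0 ≤ x.re := hx
      simp only [id, Complex.add_re, Complex.one_re]; linarith))).hasDerivWithinAt
  have hb : ∀ x ∈ {x : ℂ | 0 ≤ x.re}, ‖1 / (1 + x)‖ ≤ 1 := by
    intro x hx
    have hx : 0 ≤ x.re := hx
    have h1 := Complex.re_le_norm (1 + x)
    simp only [Complex.add_re, Complex.one_re] at h1
    rw [norm_div, norm_one]
    exact (div_le_one (by linarith)).2 (by linarith)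
  have := Convex.norm_image_sub_le_of_norm_hasDerivWithin_le hs hb
    (convex_halfSpace_re_ge 0) (x := 0) (y := w) (by simp) hw
  simpa using this

/-- The logarithm of the canonical product `∏ (1 + u / n j)`. -/
noncomputable def logCanonicalProduct (n : ℕ → ℝ) (u : ℂ) : ℂ :=
  ∑' j, Complex.log (1 + u / n j)

section canonical

variable {n : ℕ → ℝ}

theorem re_div_nonneg (hn : ∀ j, 0 < n j) {u : ℂ} (hu : 0 ≤ u.re) (j : ℕ) :
    0 ≤ (u / n j).re := by
  rw [Complex.div_ofReal_re]
  exact div_nonneg hu (hn j).le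

theorem norm_log_one_add_div_le (hn : ∀ j, 0 < n j) {u : ℂ} (hu : 0 ≤ u.re) (j : ℕ) :
    ‖Complex.log (1 + u / n j)‖ ≤ ‖u‖ * (n j)⁻¹ := by
  refine (Complex.norm_log_one_add_le_of_re_nonneg (re_div_nonneg hn hu j)).trans_eq ?_
  rw [norm_div, Complex.norm_real, Real.norm_of_nonneg (hn j).le, div_eq_mul_inv]

theorem differentiableOn_logCanonicalProduct (hn : ∀ j, 0 < n j)
    (hs : Summable fun j => (n j)⁻¹) :
    DifferentiableOn ℂ (logCanonicalProduct n) {u | 0 < u.re} := by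
  intro u hu
  -- The Weierstrass test needs a bound uniform in the variable, hence the bounded neighbourhood.
  have hO : IsOpen ({u : ℂ | 0 < u.re} ∩ Metric.ball 0 (‖u‖ + 1)) :=
    (isOpen_lt continuous_const Complex.continuous_re).inter Metric.isOpen_ball
  have hd : DifferentiableOn ℂ (fun u => ∑' j, Complex.log (1 + u / n j))
      ({u : ℂ | 0 < u.re} ∩ Metric.ball 0 (‖u‖ + 1)) := by
    refine Complex.differentiableOn_tsum_of_summable_norm (hs.mul_left (‖u‖ + 1)) ?_ hO ?_
    · intro j v hv
      have h1 := re_div_nonneg hn (le_of_lt hv.1) j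
      exact (((differentiableAt_id.div_const _).const_add 1).clog (Or.inl (by
        simp only [Complex.add_re, Complex.one_re]; linarith))).differentiableWithinAt
    · intro j v hv
      have h2 : ‖v‖ < ‖u‖ + 1 := by simpa using hv.2
      exact (norm_log_one_add_div_le hn (le_of_lt hv.1) j).trans
        (mul_le_mul_of_nonneg_right h2.le (inv_pos.2 (hn j)).le)
  exact (hd.differentiableAt (hO.mem_nhds ⟨hu, by simp⟩)).differentiableWithinAt

theorem hasSum_re_logCanonicalProduct (hn : ∀ j, 0 < n j) (hs : Summable fun j => (n j)⁻¹)
    {u : ℂ} (hu : 0 ≤ u.re) :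
    HasSum (fun j => Real.log ‖1 + u / n j‖) (logCanonicalProduct n u).re := by
  have h1 : Summable fun j => Complex.log (1 + u / n j) :=
    Summable.of_norm_bounded (hs.mul_left ‖u‖) (norm_log_one_add_div_le hn hu)
  have h2 := Complex.hasSum_re h1.hasSum
  simp only [Complex.log_re] at h2
  exact h2

theorem one_le_norm_one_add {w : ℂ} (hw : 0 ≤ w.re) : 1 ≤ ‖1 + w‖ := by
  have h1 := Complex.re_le_norm (1 + w)
  simp only [Complex.add_re, Complex.one_re] at h1
  linarith

theorem norm_le_norm_one_add {w : ℂ} (hw : 0 ≤ w.re) : ‖w‖ ≤ ‖1 + w‖ := by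
  rw [Complex.norm_def, Complex.norm_def]
  refine Real.sqrt_le_sqrt ?_
  simp only [Complex.normSq_apply, Complex.add_re, Complex.one_re, Complex.add_im, Complex.one_im]
  nlinarith

/-- Factors beyond `J` have modulus at least `1` and are dropped; in the others `|1 + w| ≥ |w|`. -/
theorem sum_log_le_re_logCanonicalProduct (hn : ∀ j, 0 < n j) (hs : Summable fun j => (n j)⁻¹)
    {u : ℂ} (hu : 0 < u.re) (J : ℕ) :
    ∑ j ∈ Finset.range J, Real.log (‖u‖ / n j) ≤ (logCanonicalProduct n u).re := by
  have hu0 : 0 < ‖u‖ := norm_pos_iff.2 (by rintro rfl; simp at hu)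
  have h := hasSum_re_logCanonicalProduct hn hs hu.le
  refine le_trans (Finset.sum_le_sum fun j _ => ?_) (sum_le_hasSum (Finset.range J)
    (fun j _ => Real.log_nonneg (one_le_norm_one_add (re_div_nonneg hn hu.le j))) h)
  refine Real.log_le_log (div_pos hu0 (hn j)) ?_
  refine le_trans (le_of_eq ?_) (norm_le_norm_one_add (re_div_nonneg hn hu.le j))
  rw [norm_div, Complex.norm_real, Real.norm_of_nonneg (hn j).le]

theorem re_logCanonicalProduct_le (hn : ∀ j, 0 < n j) (hs : Summable fun j => (n j)⁻¹)
    {u : ℂ} (hu : 0 ≤ u.re) {B : ℝ}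
    (hB : ∀ k, ∑ j ∈ Finset.range k, Real.log (1 + ‖u‖ / n j) ≤ B) :
    (logCanonicalProduct n u).re ≤ B := by
  have h := hasSum_re_logCanonicalProduct hn hs hu
  rw [← h.tsum_eq]
  refine Real.tsum_le_of_sum_range_le
    (fun j => Real.log_nonneg (one_le_norm_one_add (re_div_nonneg hn hu j)))
    fun k => (Finset.sum_le_sum fun j _ => ?_).trans (hB k)
  refine Real.log_le_log (by linarith [one_le_norm_one_add (re_div_nonneg hn hu j)]) ?_
  refine (norm_add_le _ _).trans_eq ?_
  rw [norm_one, norm_div, Complex.norm_real, Real.norm_of_nonneg (hn j).le]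

end canonical

/-! ### Growth of the canonical product from above. -/

/-- A tail of a convergent Riemann series, rescaled. -/
theorem sum_range_div_rpow_le {β : ℝ} (hβ : 1 < β) {N : ℕ} (hN : 0 < N) (k : ℕ) :
    ∑ i ∈ Finset.range k, ((N : ℝ) / (N + i)) ^ β ≤ N * ∑' q : ℕ, ((q : ℝ) + 1)⁻¹ ^ β := by
  have hN' : (0 : ℝ) < N := by exact_mod_cast hN
  have hsum : Summable fun q : ℕ => ((q : ℝ) + 1)⁻¹ ^ β := by
    have := (summable_nat_add_iff 1).2 (Real.summable_nat_rpow_inv.2 hβ)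
    refine this.congr fun q => ?_
    rw [Real.inv_rpow (by positivity)]
    push_cast
    rfl
  -- Cut into blocks of length `N`: for `i ≥ q * N` the ratio is at most `1 / (q + 1)`.
  have hblock : ∀ l : ℕ, ∑ i ∈ Finset.range (l * N), ((N : ℝ) / (N + i)) ^ β ≤
      N * ∑ q ∈ Finset.range l, ((q : ℝ) + 1)⁻¹ ^ β := by
    intro l
    induction l with
    | zero => simp
    | succ l ih =>
      rw [Nat.succ_mul, Finset.sum_range_add, Finset.sum_range_succ, mul_add]
      refine add_le_add ih ?_
      refine (Finset.sum_le_card_nsmul _ _ (((l : ℝ) + 1)⁻¹ ^ β) fun i _ => ?_).trans_eq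
        (by simp)
      refine Real.rpow_le_rpow (by positivity) ?_ (by linarith)
      rw [← one_div, div_le_div_iff₀ (by positivity) (by positivity)]
      push_cast
      nlinarith [(Nat.cast_nonneg i : (0 : ℝ) ≤ i)]
  calc _ ≤ ∑ i ∈ Finset.range (k * N), ((N : ℝ) / (N + i)) ^ β :=
        Finset.sum_le_sum_of_subset_of_nonneg
          (Finset.range_mono (Nat.le_mul_of_pos_right k hN)) fun i _ _ => by positivity
    _ ≤ _ := hblock k
    _ ≤ _ := mul_le_mul_of_nonneg_left
        (hsum.sum_le_tsum _ fun i _ => by positivity) hN'.le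

section growth

variable {n : ℕ → ℝ} {β : ℝ}

theorem div_le_div_rpow_of_monotone (hn : ∀ j, 0 < n j)
    (hmono : Monotone fun j : ℕ => ((j : ℝ) + 1) ^ (-β) * n j) (J i : ℕ) :
    n J / n (J + i) ≤ (((J + 1 : ℕ) : ℝ) / ((J + 1 : ℕ) + i)) ^ β := by
  have h := hmono (Nat.le_add_right J i)
  simp only at h
  rw [Real.rpow_neg (by positivity), Real.rpow_neg (by positivity), inv_mul_eq_div,
    inv_mul_eq_div, div_le_div_iff₀ (by positivity) (by positivity)] at h
  rw [Real.div_rpow (by positivity) (by positivity),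
    div_le_div_iff₀ (hn _) (by positivity)]
  push_cast at h ⊢
  rw [add_right_comm (J : ℝ) 1 i]
  linarith

theorem summable_inv_of_monotone (hβ : 1 < β) (hn : ∀ j, 0 < n j)
    (hmono : Monotone fun j : ℕ => ((j : ℝ) + 1) ^ (-β) * n j) :
    Summable fun j => (n j)⁻¹ := by
  refine summable_of_sum_range_le (c := (n 0)⁻¹ * (1 * ∑' q : ℕ, ((q : ℝ) + 1)⁻¹ ^ β))
    (fun j => (inv_pos.2 (hn j)).le) fun k => ?_
  have h := sum_range_div_rpow_le hβ one_pos k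
  rw [Nat.cast_one] at h
  refine le_trans ?_ (mul_le_mul_of_nonneg_left h (inv_pos.2 (hn 0)).le)
  rw [Finset.mul_sum]
  refine Finset.sum_le_sum fun i _ => ?_
  have := div_le_div_rpow_of_monotone hn hmono 0 i
  rw [zero_add, zero_add, Nat.cast_one, div_eq_mul_inv] at this
  rw [inv_mul_eq_div, le_div_iff₀ (hn 0), mul_comm]
  exact this

/-- The head, where `n j ≤ s`, satisfies `1 + x ≤ 2x`. The tail is `O(J + 1)` by comparison with a
Riemann series, and `J * log 2` is at most the head sum, thanks to the factor `2`. -/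
theorem exists_sum_log_one_add_le (hβ : 1 < β) (hn : ∀ j, 0 < n j)
    (hmono : Monotone fun j : ℕ => ((j : ℝ) + 1) ^ (-β) * n j) :
    ∃ C : ℝ, 0 < C ∧ ∀ s : ℝ, 0 < s → ∃ J : ℕ, ∀ k,
      ∑ j ∈ Finset.range k, Real.log (1 + s / n j) ≤
        C + C * ∑ j ∈ Finset.range J, Real.log (2 * s / n j) := by
  set Z := ∑' q : ℕ, ((q : ℝ) + 1)⁻¹ ^ β with hZ
  have hZ0 : 0 ≤ Z := tsum_nonneg fun q => by positivity
  have hl2 : 0 < Real.log 2 := Real.log_pos one_lt_two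
  refine ⟨1 + Z + Z / Real.log 2, by positivity, fun s hs => ?_⟩
  have hex : ∃ j, s < n j := by
    have h := (summable_inv_of_monotone hβ hn hmono).tendsto_atTop_zero
    obtain ⟨j, hj⟩ := (h.eventually (gt_mem_nhds (inv_pos.2 hs))).exists
    exact ⟨j, (inv_lt_inv₀ (hn j) hs).1 hj⟩
  classical
  -- `J` is the first index with `s < n J`.
  obtain ⟨J, hJ, hlt⟩ : ∃ J, s < n J ∧ ∀ j < J, n j ≤ s :=
    ⟨Nat.find hex, Nat.find_spec hex, fun j hj => not_lt.1 (Nat.find_min hex hj)⟩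
  refine ⟨J, fun k => ?_⟩
  set T := ∑ j ∈ Finset.range J, Real.log (2 * s / n j) with hT
  have hpos : ∀ j, 0 < s / n j := fun j => div_pos hs (hn j)
  have hhead : ∑ j ∈ Finset.range J, Real.log (1 + s / n j) ≤ T := by
    refine Finset.sum_le_sum fun j hj => Real.log_le_log (by linarith [hpos j]) ?_
    have : 1 ≤ s / n j := (one_le_div (hn j)).2 (hlt j (Finset.mem_range.1 hj))
    rw [mul_div_assoc]
    linarith
  have hJT : J * Real.log 2 ≤ T := by
    have := Finset.card_nsmul_le_sum (Finset.range J) (fun j => Real.log (2 * s / n j))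
      (Real.log 2) fun j hj => Real.log_le_log two_pos ?_
    · simpa using this
    · have : 1 ≤ s / n j := (one_le_div (hn j)).2 (hlt j (Finset.mem_range.1 hj))
      rw [mul_div_assoc]
      linarith
  have htail : ∑ i ∈ Finset.range k, Real.log (1 + s / n (J + i)) ≤ (J + 1) * Z := by
    have h := sum_range_div_rpow_le hβ J.succ_pos k
    push_cast at h
    refine le_trans (Finset.sum_le_sum fun i _ => ?_) h
    have h1 := div_le_div_rpow_of_monotone hn hmono J i
    push_cast at h1
    have h2 := Real.log_le_sub_one_of_pos (x := 1 + s / n (J + i)) (by linarith [hpos (J + i)])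
    have h3 : s / n (J + i) ≤ n J / n (J + i) := div_le_div_of_nonneg_right hJ.le (hn _).le
    linarith
  have hTZ : J * Z ≤ Z / Real.log 2 * T := by
    rw [div_mul_eq_mul_div, le_div_iff₀ hl2]
    nlinarith
  have hT0 : 0 ≤ T := le_trans (by positivity) hJT
  calc _ ≤ ∑ j ∈ Finset.range (J + k), Real.log (1 + s / n j) :=
        Finset.sum_le_sum_of_subset_of_nonneg (Finset.range_mono (Nat.le_add_left k J))
          fun j _ _ => Real.log_nonneg (by linarith [hpos j])
    _ ≤ T + (J + 1) * Z := by
        rw [Finset.sum_range_add]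
        exact add_le_add hhead htail
    _ ≤ _ := by
        have : 0 ≤ Z / Real.log 2 := by positivity
        nlinarith [mul_nonneg hZ0 hT0]

end growth

/-! ### The function `h_M` -/

theorem StronglyRegular.one_le {M : ℕ → ℝ} (hM : StronglyRegular M) (j : ℕ) : 1 ≤ M j :=
  hM.one ▸ hM.mono (Nat.zero_le j)

theorem StronglyRegular.pos {M : ℕ → ℝ} (hM : StronglyRegular M) (j : ℕ) : 0 < M j :=
  one_pos.trans_le (hM.one_le j)

theorem StronglyRegular.quotientSeq_pos {M : ℕ → ℝ} (hM : StronglyRegular M) (j : ℕ) :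
    0 < quotientSeq M j :=
  div_pos (hM.pos _) (hM.pos _)

theorem StronglyRegular.sum_log_quotientSeq {M : ℕ → ℝ} (hM : StronglyRegular M) (J : ℕ) :
    ∑ j ∈ Finset.range J, Real.log (quotientSeq M j) = Real.log (M J) := by
  induction J with
  | zero => simp [hM.one]
  | succ J ih =>
    rw [Finset.sum_range_succ, ih, quotientSeq, Real.log_div (hM.pos _).ne' (hM.pos _).ne']
    ring

section hFun

variable {M : ℕ → ℝ}

theorem StronglyRegular.bddBelow_range (hM : StronglyRegular M) {t : ℝ} (ht : 0 ≤ t) :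
    BddBelow (Set.range fun j : ℕ => t ^ j * M j) :=
  ⟨0, by rintro _ ⟨j, rfl⟩; exact mul_nonneg (pow_nonneg ht j) (hM.pos j).le⟩

theorem hFun_le (hM : StronglyRegular M) {t : ℝ} (ht : 0 < t) (j : ℕ) : hFun M t ≤ t ^ j * M j := by
  rw [hFun, if_pos ht]
  exact ciInf_le (hM.bddBelow_range ht.le) j

theorem le_hFun {t c : ℝ} (ht : 0 < t) (h : ∀ j, c ≤ t ^ j * M j) : c ≤ hFun M t := by
  rw [hFun, if_pos ht]
  exact le_ciInf h

theorem hFun_nonneg (hM : StronglyRegular M) {t : ℝ} (ht : 0 < t) : 0 ≤ hFun M t :=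
  le_hFun ht fun j => mul_nonneg (pow_nonneg ht.le j) (hM.pos j).le

theorem hFun_le_one (hM : StronglyRegular M) {t : ℝ} (ht : 0 < t) : hFun M t ≤ 1 := by
  simpa [hM.one] using hFun_le hM ht 0

theorem hFun_mono (hM : StronglyRegular M) {s t : ℝ} (hs : 0 < s) (hst : s ≤ t) : hFun M s ≤ hFun M t :=
  le_hFun (hs.trans_le hst) fun j => (hFun_le hM hs j).trans
    (mul_le_mul_of_nonneg_right (pow_le_pow_left₀ hs.le hst j) (hM.pos j).le)

/-- Moderate growth, in terms of `h_M`. -/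
theorem exists_hFun_le_sq (hM : StronglyRegular M) :
    ∃ A : ℝ, 0 < A ∧ ∀ t, 0 < t → hFun M t ≤ hFun M (A * t) ^ 2 := by
  obtain ⟨A, hA, hmg, -⟩ := hM.growth
  refine ⟨A, hA, fun t ht => ?_⟩
  have hAt : 0 < A * t := mul_pos hA ht
  have h0 := hFun_nonneg hM hAt
  -- Lets the infimum be taken in each factor of the square separately.
  have hmul : ∀ r : ℝ, 0 ≤ r → ∀ c, (∀ j, c ≤ r * ((A * t) ^ j * M j)) →
      c ≤ r * hFun M (A * t) := fun r hr c hc => by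
    rw [hFun, if_pos hAt, Real.mul_iInf_of_nonneg hr]
    exact le_ciInf hc
  rw [sq]
  refine hmul _ h0 _ fun j => ?_
  rw [mul_comm]
  refine hmul _ (mul_nonneg (pow_nonneg hAt.le j) (hM.pos j).le) _ fun k => ?_
  refine (hFun_le hM ht (j + k)).trans
    ((mul_le_mul_of_nonneg_left (hmg j k) (pow_nonneg ht.le _)).trans_eq ?_)
  ring

theorem hFun_le_pow (hM : StronglyRegular M) {A : ℝ} (hA : 0 < A) (h : ∀ t, 0 < t → hFun M t ≤ hFun M (A * t) ^ 2)
    (N : ℕ) :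
    ∀ t, 0 < t → hFun M t ≤ hFun M (A ^ N * t) ^ 2 ^ N := by
  induction N with
  | zero => simp
  | succ N ih =>
    intro t ht
    refine (ih t ht).trans ?_
    have h1 : 0 < A ^ N * t := by positivity
    refine (pow_le_pow_left₀ (hFun_nonneg hM h1) (h _ h1) _).trans_eq ?_
    rw [← pow_mul, ← mul_assoc, ← pow_succ', ← pow_succ']

/-- The loss of a power of `t` in Cauchy's estimates is compensated by a dilation. -/
theorem hFun_le_mul_pow (hM : StronglyRegular M) {A : ℝ} (hA : 0 < A)
    (h : ∀ t, 0 < t → hFun M t ≤ hFun M (A * t) ^ 2) {t : ℝ} (ht : 0 < t) (j : ℕ) :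
    hFun M t ≤ hFun M (A * t) * ((A * t) ^ j * M j) := by
  have hAt := mul_pos hA ht
  refine (h t ht).trans ?_
  rw [sq]
  exact mul_le_mul_of_nonneg_left (hFun_le hM hAt j) (hFun_nonneg hM hAt)

end hFun

/-! ### The flat function -/

theorem re_exp_neg_div_pos {θ : ℝ} (hθ : 0 < θ) {ζ : ℂ} (hζ : |ζ.im| < θ * (Real.pi / 2)) :
    0 < (Complex.exp (-ζ / θ)).re := by
  rw [Complex.exp_re, Complex.div_ofReal_im, Complex.neg_im]
  refine mul_pos (Real.exp_pos _) (Real.cos_pos_of_mem_Ioo (abs_lt.1 ?_))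
  rw [abs_div, abs_neg, abs_of_pos hθ, div_lt_iff₀ hθ]
  linarith

theorem norm_exp_neg_div (θ : ℝ) (ζ : ℂ) :
    ‖Complex.exp (-ζ / θ)‖ = Real.exp (-ζ.re / θ) := by
  rw [Complex.norm_exp, Complex.div_ofReal_re, Complex.neg_re]

theorem exists_nonvanishing_hFun_bounds {M : ℕ → ℝ} (hM : StronglyRegular M) {θ δ : ℝ}
    (hθ : 0 < θ) (hθδ : θ < δ) (hP : PropertyP M δ) :
    ∃ (G : LogSurface → ℂ) (κ₁ κ₂ κ₃ : ℝ), 0 < κ₁ ∧ 0 < κ₂ ∧ 0 < κ₃ ∧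
      DifferentiableOn ℂ (fun ζ => G ⟨ζ⟩) {ζ : ℂ | |ζ.im| < θ * (Real.pi / 2)} ∧
      (∀ z, G z ≠ 0) ∧
      ∀ z ∈ LogSurface.sector θ,
        κ₁ * hFun M (κ₂ * z.modulus) ≤ ‖G z‖ ∧ ‖G z‖ ≤ hFun M (κ₃ * z.modulus) := by
  obtain ⟨m', a, ha, hmono, hm'⟩ := hP
  have ha0 : 0 < a := one_pos.trans_le ha
  have hq := hM.quotientSeq_pos
  have hm'0 : ∀ j, 0 < m' j := fun j =>
    (mul_pos (inv_pos.2 ha0) (hq j)).trans_le (hm' j).1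
  have hlog_le : ∀ j, Real.log (m' j) ≤ Real.log a + Real.log (quotientSeq M j) := fun j => by
    rw [← Real.log_mul ha0.ne' (hq j).ne']
    exact Real.log_le_log (hm'0 j) (hm' j).2
  have hle_log : ∀ j, Real.log (quotientSeq M j) ≤ Real.log a + Real.log (m' j) := fun j => by
    rw [← Real.log_mul ha0.ne' (hm'0 j).ne']
    exact Real.log_le_log (hq j) ((inv_mul_le_iff₀ ha0).1 (hm' j).1)
  set n : ℕ → ℝ := fun j => m' j ^ (1 / θ) with hn_def
  have hn : ∀ j, 0 < n j := fun j => Real.rpow_pos_of_pos (hm'0 j) _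
  have hlogn : ∀ j, Real.log (n j) = Real.log (m' j) / θ := fun j => by
    rw [hn_def]
    simp only
    rw [Real.log_rpow (hm'0 j)]
    ring
  have hβ : 1 < δ / θ := (one_lt_div hθ).2 hθδ
  have hnmono : Monotone fun j : ℕ => ((j : ℝ) + 1) ^ (-(δ / θ)) * n j := by
    have : (fun j : ℕ => ((j : ℝ) + 1) ^ (-(δ / θ)) * n j) =
        fun j : ℕ => (((j : ℝ) + 1) ^ (-δ) * m' j) ^ (1 / θ) := by
      funext j
      rw [Real.mul_rpow (by positivity) (hm'0 j).le, ← Real.rpow_mul (by positivity)]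
      congr 2
      ring
    rw [this]
    intro i j hij
    exact Real.rpow_le_rpow (mul_nonneg (by positivity) (hm'0 i).le) (hmono hij)
      (by positivity)
  have hs := summable_inv_of_monotone hβ hn hnmono
  obtain ⟨C, hC, hCs⟩ := exists_sum_log_one_add_le hβ hn hnmono
  obtain ⟨A, hA, hsq⟩ := exists_hFun_le_sq hM
  -- With `ζ = log z`, the argument of the product is `z ^ (-1/θ)`.
  set Ψ : ℂ → ℂ := fun ζ => logCanonicalProduct n (Complex.exp (-ζ / θ)) with hΨ
  have hnorm : ∀ ζ, ‖Complex.exp (-(θ : ℂ) * Ψ ζ)‖ = Real.exp (-(θ * (Ψ ζ).re)) := fun ζ => by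
    rw [Complex.norm_exp, ← Complex.ofReal_neg, Complex.re_ofReal_mul, neg_mul]
  have hupper : ∀ ζ : ℂ, |ζ.im| < θ * (Real.pi / 2) →
      Real.exp (-(θ * (Ψ ζ).re)) ≤ hFun M (a * Real.exp ζ.re) := by
    intro ζ hζ
    refine le_hFun (by positivity) fun J => ?_
    rw [← Real.le_log_iff_exp_le (mul_pos (by positivity) (hM.pos J)),
      Real.log_mul (by positivity) (hM.pos J).ne', Real.log_pow,
      Real.log_mul ha0.ne' (Real.exp_pos _).ne', Real.log_exp, ← hM.sum_log_quotientSeq]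
    have h1 := sum_log_le_re_logCanonicalProduct hn hs (re_exp_neg_div_pos hθ hζ) J
    have h2 : -(θ * (Ψ ζ).re) ≤
        -(θ * ∑ j ∈ Finset.range J, Real.log (‖Complex.exp (-ζ / θ)‖ / n j)) :=
      neg_le_neg (mul_le_mul_of_nonneg_left h1 hθ.le)
    refine h2.trans ?_
    have h3 : (J : ℝ) * (Real.log a + ζ.re) + ∑ j ∈ Finset.range J, Real.log (quotientSeq M j) =
        ∑ j ∈ Finset.range J, (Real.log a + ζ.re + Real.log (quotientSeq M j)) := by
      simp [Finset.sum_add_distrib, mul_add]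
    rw [h3, Finset.mul_sum, ← Finset.sum_neg_distrib]
    refine Finset.sum_le_sum fun j _ => ?_
    rw [norm_exp_neg_div, Real.log_div (Real.exp_pos _).ne' (hn j).ne', Real.log_exp, hlogn]
    have : -(θ * (-ζ.re / θ - Real.log (m' j) / θ)) = ζ.re + Real.log (m' j) := by
      field_simp
      ring
    linarith [hlog_le j]
  -- The upper bound at the positive real point of modulus `t / a` bounds `h_M t` below by an
  -- exponential.
  have hpos : ∀ t, 0 < t → 0 < hFun M t := fun t ht => by
    have h := hupper (Real.log (t / a) : ℝ) (by simpa using by positivity)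
    rw [Complex.ofReal_re, Real.exp_log (by positivity), mul_div_cancel₀ _ ha0.ne'] at h
    exact (Real.exp_pos _).trans_le h
  -- The lower bound first appears with `h_M` to the power `C`; as `h_M ≤ 1`, the power `2 ^ N` is
  -- smaller, and `N` uses of moderate growth remove it. In `q = 2 ^ (-θ) / a`, the `2` comes from
  -- the head sum and `a` from comparing `m'` with the quotients.
  obtain ⟨N, hN⟩ := pow_unbounded_of_one_lt C one_lt_two
  set q : ℝ := Real.exp (-(θ * Real.log 2)) / a with hq_def
  have hq0 : 0 < q := by positivity
  have hlower : ∀ ζ : ℂ, |ζ.im| < θ * (Real.pi / 2) →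
      Real.exp (-(θ * C)) * hFun M (q / A ^ N * Real.exp ζ.re) ≤
        Real.exp (-(θ * (Ψ ζ).re)) := by
    intro ζ hζ
    obtain ⟨J, hJ⟩ := hCs _ (Real.exp_pos (-ζ.re / θ))
    rw [← norm_exp_neg_div θ ζ] at hJ
    have h1 := re_logCanonicalProduct_le hn hs (re_exp_neg_div_pos hθ hζ).le hJ
    have hqx : 0 < q * Real.exp ζ.re := by positivity
    have hqx' : 0 < q / A ^ N * Real.exp ζ.re := by positivity
    have h2 : θ * ∑ j ∈ Finset.range J, Real.log (2 * ‖Complex.exp (-ζ / θ)‖ / n j) ≤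
        -Real.log (hFun M (q * Real.exp ζ.re)) := by
      have h3 := Real.log_le_log (hpos _ hqx) (hFun_le hM hqx J)
      rw [Real.log_mul (by positivity) (hM.pos J).ne', Real.log_pow,
        Real.log_mul hq0.ne' (Real.exp_pos _).ne', Real.log_exp, ← hM.sum_log_quotientSeq,
        hq_def, Real.log_div (Real.exp_pos _).ne' ha0.ne', Real.log_exp] at h3
      refine le_trans ?_ (neg_le_neg h3)
      have h4 : -((J : ℝ) * (-(θ * Real.log 2) - Real.log a + ζ.re) +
            ∑ j ∈ Finset.range J, Real.log (quotientSeq M j)) =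
          ∑ j ∈ Finset.range J, (θ * Real.log 2 + Real.log a - ζ.re
            - Real.log (quotientSeq M j)) := by
        rw [Finset.sum_sub_distrib, Finset.sum_const, Finset.card_range, nsmul_eq_mul]
        ring
      rw [h4, Finset.mul_sum]
      refine Finset.sum_le_sum fun j _ => ?_
      rw [norm_exp_neg_div, Real.log_div (by positivity) (hn j).ne',
        Real.log_mul two_ne_zero (Real.exp_pos _).ne', Real.log_exp, hlogn]
      have : θ * (Real.log 2 + -ζ.re / θ - Real.log (m' j) / θ) =
          θ * Real.log 2 - ζ.re - Real.log (m' j) := by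
        field_simp
        ring
      linarith [hle_log j]
    have h5 : Real.log (hFun M (q / A ^ N * Real.exp ζ.re)) ≤
        2 ^ N * Real.log (hFun M (q * Real.exp ζ.re)) := by
      have h6 := Real.log_le_log (hpos _ hqx') (hFun_le_pow hM hA hsq N _ hqx')
      rw [Real.log_pow] at h6
      push_cast at h6
      rwa [show A ^ N * (q / A ^ N * Real.exp ζ.re) = q * Real.exp ζ.re by
        field_simp] at h6
    have h7 : Real.log (hFun M (q * Real.exp ζ.re)) ≤ 0 :=
      Real.log_nonpos (hpos _ hqx).le (hFun_le_one hM hqx)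
    rw [← Real.exp_log (hpos _ hqx'), ← Real.exp_add, Real.exp_le_exp]
    have h8 : θ * (Ψ ζ).re ≤ θ * C + C * -Real.log (hFun M (q * Real.exp ζ.re)) := by
      calc θ * (Ψ ζ).re ≤ θ * _ := mul_le_mul_of_nonneg_left h1 hθ.le
        _ = θ * C + C *
            (θ * ∑ j ∈ Finset.range J, Real.log (2 * ‖Complex.exp (-ζ / θ)‖ / n j)) := by ring
        _ ≤ _ := add_le_add_right (mul_le_mul_of_nonneg_left h2 hC.le) _
    nlinarith
  -- An exponential has no zeros, even outside the sector where the series may diverge.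
  refine ⟨fun z => Complex.exp (-(θ : ℂ) * Ψ z.logValue), Real.exp (-(θ * C)), q / A ^ N, a,
    Real.exp_pos _, by positivity, ha0, ?_, fun z => Complex.exp_ne_zero _, fun z hz => ?_⟩
  · refine DifferentiableOn.cexp (DifferentiableOn.const_mul ?_ _)
    refine (differentiableOn_logCanonicalProduct hn hs).comp
      (t := {u | 0 < u.re}) (f := fun ζ : ℂ => Complex.exp (-ζ / θ)) ?_ fun ζ hζ => ?_
    · exact (differentiable_id.neg.div_const _).cexp.differentiableOn
    · exact re_exp_neg_div_pos hθ hζ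
  · rw [hnorm]
    exact ⟨hlower _ hz, hupper _ hz⟩

/-! ### Derivative bounds and flatness. -/

theorem theorem2p1 (M : ℕ → ℝ) (hM : StronglyRegular M) (γ : ℝ) (hγ : 0 < γ)
    (hγM : (γ : EReal) < growthIndex M) :
    ∃ κ₁ κ₂ κ₃ b₁ b₂ c₁ c₂ c₃ : ℝ,
      0 < κ₁ ∧ 0 < κ₂ ∧ 0 < κ₃ ∧ 0 < b₁ ∧ 0 < b₂ ∧ 0 < c₁ ∧ 0 < c₂ ∧ 0 < c₃ ∧
      ∃ G ∈ LogSurface.ultraholomorphicClass M (LogSurface.sector γ),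
        LogSurface.FlatAtVertex G (LogSurface.sector γ) ∧
        (∀ z ∈ LogSurface.sector γ,
          κ₁ * hFun M (κ₂ * z.modulus) ≤ ‖G z‖ ∧ ‖G z‖ ≤ hFun M (κ₃ * z.modulus)) ∧
        (∀ z ∈ LogSurface.sector γ, G z ≠ 0) ∧
        (∀ z ∈ LogSurface.sector γ, ∀ j : ℕ,
          ‖LogSurface.iteratedDeriv j G z‖ ≤
            b₁ ^ j * (j.factorial : ℝ) * M j * hFun M (b₂ * z.modulus)) ∧
        (∀ z ∈ LogSurface.sector γ, ∀ j : ℕ,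
          ‖LogSurface.iteratedDeriv j (fun w => (G w)⁻¹) z‖ ≤
            c₁ * c₂ ^ j * (j.factorial : ℝ) * M j * (hFun M (c₃ * z.modulus))⁻¹) := by
  obtain ⟨_, ⟨δ, -, hP, rfl⟩, hγδ⟩ := lt_sSup_iff.1 hγM
  have hγδ : γ < δ := EReal.coe_lt_coe_iff.1 hγδ
  obtain ⟨θ, hγθ, hθδ⟩ := exists_between hγδ
  have hθ : 0 < θ := hγ.trans hγθ
  obtain ⟨G, κ₁, κ₂, κ₃, hκ₁, hκ₂, hκ₃, hG, hG0, hGb⟩ :=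
    exists_nonvanishing_hFun_bounds hM hθ hθδ hP
  obtain ⟨A, hA, hsq⟩ := exists_hFun_le_sq hM
  have hpos : ∀ t, 0 < t → 0 < hFun M t := fun t ht => by
    have h := (hGb ⟨(Real.log (t / κ₃) : ℝ)⟩ (by
      simpa [LogSurface.sector, LogSurface.arg] using by positivity)).2
    rw [LogSurface.modulus, Complex.ofReal_re, Real.exp_log (by positivity),
      mul_div_cancel₀ _ hκ₃.ne'] at h
    exact (norm_pos_iff.2 (hG0 _)).trans_le h
  have hsub : LogSurface.sector γ ⊆ LogSurface.sector θ := fun z hz =>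
    lt_of_lt_of_le hz (mul_le_mul_of_nonneg_right hγθ.le (by positivity))
  obtain ⟨r, hr, hr', hrγ⟩ : ∃ r : ℝ, 0 < r ∧ r < 1 / 4 ∧ 3 * r ≤ (θ - γ) * (Real.pi / 2) := by
    have h : 0 < (θ - γ) * (Real.pi / 2) := mul_pos (sub_pos.2 hγθ) (by positivity)
    refine ⟨min (1 / 8) ((θ - γ) * (Real.pi / 2) / 3), by positivity,
      (min_le_left _ _).trans_lt (by norm_num), ?_⟩
    linarith [min_le_right (1 / 8 : ℝ) ((θ - γ) * (Real.pi / 2) / 3)]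
  have hr1 : 0 < 1 - r := by linarith
  -- On the Cauchy disc moduli lie between `(1 - r)|z|` and `(1 + r)|z|`: the outer one serves `G`,
  -- the inner one `1/G`. The factor `A` pays for `|z|^(-j)`.
  set b : ℝ := A * (κ₃ * (1 + r)) with hb_def
  have hb : 0 < b := by positivity
  set c : ℝ := κ₂ * (1 - r) with hc_def
  have hc : 0 < c := by positivity
  have hderiv : ∀ z ∈ LogSurface.sector γ, ∀ j : ℕ, ‖LogSurface.iteratedDeriv j G z‖ ≤
      (b / r) ^ j * (j.factorial : ℝ) * M j * hFun M (b * z.modulus) := by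
    intro z hz j
    have hm := z.modulus_pos
    refine (LogSurface.norm_iteratedDeriv_le hG hr hr' hrγ hz
      (B := hFun M (κ₃ * (1 + r) * z.modulus)) (fun q hq _ hq' => (hGb q hq).2.trans ?_)
      j).trans ?_
    · refine hFun_mono hM (mul_pos hκ₃ q.modulus_pos) ?_
      rw [mul_assoc]
      exact mul_le_mul_of_nonneg_left hq' hκ₃.le
    · have h := hFun_le_mul_pow hM hA hsq (t := κ₃ * (1 + r) * z.modulus) (by positivity) j
      rw [← mul_assoc A, ← hb_def] at h
      rw [div_le_iff₀ (by positivity)]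
      refine (mul_le_mul_of_nonneg_left h (Nat.cast_nonneg _)).trans_eq ?_
      rw [div_pow, mul_pow, mul_pow]
      field_simp
      ring
  have hderiv_inv : ∀ z ∈ LogSurface.sector γ, ∀ j : ℕ,
      ‖LogSurface.iteratedDeriv j (fun w => (G w)⁻¹) z‖ ≤
        κ₁⁻¹ * (c / r) ^ j * (j.factorial : ℝ) * M j * (hFun M (c / A * z.modulus))⁻¹ := by
    intro z hz j
    have hm := z.modulus_pos
    have hcm := hpos (c * z.modulus) (by positivity)
    have hcA := hpos (c / A * z.modulus) (by positivity)
    refine (LogSurface.norm_iteratedDeriv_le (hG.inv fun ζ _ => hG0 ⟨ζ⟩) hr hr' hrγ hz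
      (B := (κ₁ * hFun M (c * z.modulus))⁻¹) (fun q hq hq' _ => ?_) j).trans ?_
    · rw [norm_inv]
      refine inv_anti₀ (by positivity) (le_trans ?_ (hGb q hq).1)
      refine mul_le_mul_of_nonneg_left (hFun_mono hM (by positivity) ?_) hκ₁.le
      rw [mul_assoc]
      exact mul_le_mul_of_nonneg_left hq' hκ₂.le
    · have h := hFun_le_mul_pow hM hA hsq (t := c / A * z.modulus) (by positivity) j
      rw [show A * (c / A * z.modulus) = c * z.modulus by field_simp] at h
      have h' : (hFun M (c * z.modulus))⁻¹ ≤
          (c * z.modulus) ^ j * M j * (hFun M (c / A * z.modulus))⁻¹ := by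
        rw [← div_eq_mul_inv, le_div_iff₀ hcA, inv_mul_le_iff₀ hcm]
        exact h
      rw [div_le_iff₀ (by positivity), mul_inv]
      refine (mul_le_mul_of_nonneg_left (mul_le_mul_of_nonneg_left h' (inv_pos.2 hκ₁).le)
        (Nat.cast_nonneg _)).trans_eq ?_
      rw [div_pow, mul_pow, mul_pow]
      field_simp
      ring
  have hMj := hM.pos
  refine ⟨κ₁, κ₂, κ₃, b / r, b, κ₁⁻¹, c / r, c / A, hκ₁, hκ₂, hκ₃, by positivity, hb,
    by positivity, by positivity, by positivity, G, ⟨fun z hz => ?_, 1, b / r, one_pos,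
    by positivity, fun j z hz => ?_⟩, fun j => ?_, fun z hz => hGb z (hsub hz),
    fun z _ => hG0 z, hderiv, hderiv_inv⟩
  · have hU : IsOpen {ζ : ℂ | |ζ.im| < θ * (Real.pi / 2)} :=
      isOpen_lt (continuous_abs.comp Complex.continuous_im) continuous_const
    exact ⟨_, LogSurface.hasDerivAt_of_logCoord
      (hG.differentiableAt (hU.mem_nhds (hsub hz))).hasDerivAt⟩
  · rw [one_mul]
    refine (hderiv z hz j).trans (mul_le_of_le_one_right ?_ ?_)
    · have := hMj j
      positivity
    · exact hFun_le_one hM (mul_pos hb z.modulus_pos)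
  -- For flatness the term of index `1` suffices: `h_M t ≤ t * M 1`.
  · have hlim : Tendsto (fun z : LogSurface => (b / r) ^ j * (j.factorial : ℝ) * M j *
        (b * z.modulus * M 1)) (LogSurface.vertexWithin (LogSurface.sector γ)) (𝓝 0) := by
      have h : Tendsto LogSurface.modulus (LogSurface.vertexWithin (LogSurface.sector γ))
          (𝓝 0) := tendsto_comap.mono_left inf_le_left
      simpa using ((h.const_mul b).mul_const (M 1)).const_mul
        ((b / r) ^ j * (j.factorial : ℝ) * M j)
    refine squeeze_zero_norm' ?_ hlim
    have hmem : LogSurface.sector γ ∈ LogSurface.vertexWithin (LogSurface.sector γ) :=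
      mem_inf_of_right (mem_principal_self _)
    filter_upwards [hmem] with z hz
    refine (hderiv z hz j).trans (mul_le_mul_of_nonneg_left ?_ ?_)
    · simpa using hFun_le hM (mul_pos hb z.modulus_pos) 1
    · have := hMj j
      positivity
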